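/- Let $1\le t\le\infty$ and $n\ge 0$. For finite $t$ let $\mathbb{Z}_t\subseteq S^1\subset\mathbb{C}$ denote the group of $t$-th roots of unity, and let $\mathbb{Z}_\infty=S^1$ be the whole unit circle; $\mathbb{Z}_t$ acts on the unit sphere $S^{2n+1}\subset\mathbb{C}^{n+1}$ by complex scalar multiplication. For a topological group $G$ acting continuously on a space $X$, let $\mathrm{TC}_G(X)$ be the (reduced) equivariant topological complexity of Colman and Grant: the least integer $k\ge 0$ such that $X\times X$, with the diagonal action, can be covered by $k+1$ open $G$-invariant subsets $U_0,\dots,U_k$, on each of which there is a continuous $G$-equivariant map $s_j\colon U_j\to X^{[0,1]}$ (where $X^{[0,1]}$ is the space of paths in $X$ with the compact-open topology and the pointwise action) whose composite with the end-points evaluation map $X^{[0,1]}\to X\times X$, $\gamma\mapsto(\gamma(0),\gamma(1))$, is $G$-equivariantly homotopic to the inclusion $U_j\hookrightarrow X\times X$; put $\mathrm{TC}_G(X)=\infty$ if no such $k$ exists. Then $$\mathrm{TC}_{\mathbb{Z}_t}(S^{2n+1})=1 .$$ -/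

import Mathlib

open scoped unitInterval

/-- The odd-dimensional sphere `S^{2n+1}`, as the unit sphere of the Hermitian space `ℂ^{n+1}`. -/
abbrev OddSphere (n : ℕ) : Type :=
  Metric.sphere (0 : EuclideanSpace ℂ (Fin (n + 1))) 1

/-- Complex scalar multiplication by unit complex numbers on the odd sphere. -/
instance OddSphere.instMulActionCircle (n : ℕ) : MulAction Circle (OddSphere n) where
  smul z x := ⟨(z : ℂ) • (x : EuclideanSpace ℂ (Fin (n + 1))), by
    have hx : ‖(x : EuclideanSpace ℂ (Fin (n + 1)))‖ = 1 := mem_sphere_zero_iff_norm.mp x.2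
    rw [mem_sphere_zero_iff_norm, norm_smul, Circle.norm_coe, hx, one_mul]⟩
  one_smul x := Subtype.ext (one_smul ℂ (x : EuclideanSpace ℂ (Fin (n + 1))))
  mul_smul z w x :=
    Subtype.ext (mul_smul (z : ℂ) (w : ℂ) (x : EuclideanSpace ℂ (Fin (n + 1))))

theorem OddSphere.coe_circle_smul {n : ℕ} (z : Circle) (x : OddSphere n) :
    ((z • x : OddSphere n) : EuclideanSpace ℂ (Fin (n + 1))) =
      (z : ℂ) • (x : EuclideanSpace ℂ (Fin (n + 1))) := rfl

/-- The circle acts continuously, so that the odd sphere is a `G`-space for `G = S¹` and, by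
restriction, for each subgroup `G` of `S¹`. -/
instance OddSphere.instContinuousSMulCircle (n : ℕ) : ContinuousSMul Circle (OddSphere n) where
  continuous_smul :=
    ((continuous_subtype_val.comp continuous_fst).smul
      (continuous_subtype_val.comp continuous_snd)).subtype_mk _

/-- The group `ℤ_t`, for `1 ≤ t ≤ ∞`: the `t`-th roots of unity in the unit circle if `t` is
finite, and the whole circle if `t = ∞` (no condition is imposed in that case). -/
def circleZ (t : ℕ∞) : Subgroup Circle where
  carrier := {z | ∀ m : ℕ, t = (m : ℕ∞) → z ^ m = 1}
  one_mem' := fun m _ => one_pow m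
  mul_mem' := fun {a b} ha hb m hm => by rw [mul_pow, ha m hm, hb m hm, one_mul]
  inv_mem' := fun {a} ha m hm => by rw [inv_pow, ha m hm, inv_one]

/-- `U ⊆ X × X` admits a local `G`-equivariant motion planner: a continuous `G`-equivariant map
`s : U → X^I` (where `X^I` has the compact-open topology and the pointwise action, and `X × X` has
the diagonal action) whose composite with the end-point map `X^I → X × X`, `γ ↦ (γ 0, γ 1)`, is
`G`-homotopic to the inclusion `U ↪ X × X`. -/
def HasEquivariantMotionPlanner (G : Type*) {X : Type*} [Group G] [TopologicalSpace X]
    [MulAction G X] (U : Set (X × X)) : Prop :=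
  ∃ (s : C(U, C(I, X))) (H : C(I × U, X × X)),
    (∀ (g : G) (p q : U), (q : X × X) = g • (p : X × X) → ∀ τ : I, s q τ = g • s p τ) ∧
    (∀ (g : G) (p q : U), (q : X × X) = g • (p : X × X) → ∀ τ : I, H (τ, q) = g • H (τ, p)) ∧
    (∀ p : U, H (0, p) = (s p 0, s p 1)) ∧
    (∀ p : U, H (1, p) = (p : X × X))

/-- The (reduced) equivariant topological complexity `TC_G(X)` of Colman and Grant: the least `k`
such that `X × X` is covered by `k + 1` open `G`-invariant subsets, each of which admits a local
`G`-equivariant motion planner; it is `⊤` if there is no such `k`. -/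
noncomputable def equivariantTC (G X : Type*) [Group G] [TopologicalSpace X] [MulAction G X] :
    ℕ∞ :=
  sInf {c : ℕ∞ | ∃ k : ℕ, c = (k : ℕ∞) ∧ ∃ U : Fin (k + 1) → Set (X × X),
    (⋃ j, U j) = Set.univ ∧
    ∀ j, IsOpen (U j) ∧ (∀ (g : G), ∀ p ∈ U j, g • p ∈ U j) ∧
      HasEquivariantMotionPlanner G (U j)}

/-!
Upper bound. For a path `u` in the circle with `u 0 = 1`, the twisted segment
`τ ↦ (1 - τ) u(τ) x + τ y` runs from `x` to `y`, and it meets the origin at most at its midpoint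
`τ = 1/2`. Where the midpoint is nonzero, radial projection onto the sphere turns it into a path
from `x` to `y`, depending continuously on `(x, y)`; since the circle is commutative, this is
equivariant for every subgroup of the circle
(`OddSphere.hasEquivariantMotionPlanner_midpointNeZero`). For `u = 1` this covers the pairs with
`x ≠ -y`, and for `u(τ) = exp (2πiτ)` those with `x ≠ y`, so two open sets suffice.

Lower bound. A motion planner on all of `X × X` makes `X` contractible
(`HasEquivariantMotionPlanner.nullhomotopic_id`), so it remains to see that a sphere is not
contractible (`not_nullhomotopic_id_sphere`). A contraction of the unit sphere gives a retraction
of the ball, which can be made smooth by approximating it away from the boundary and normalizing.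
A smooth retraction `r = id + g` is impossible (`not_exists_contDiff_retraction_sphere`), by the
argument of Milnor and Rogers: for small `t ≥ 0` the map `id + t g` is a bijection of the ball, so
that the integral of `det (1 + t Dg)` over the ball is the volume of the ball
(`setIntegral_det_one_add_smul_fderiv_eq`). This integral is polynomial in `t`, so it is the volume
at `t = 1` too, where however `det Dr = 0` because `r` takes values in the sphere.
-/

open MeasureTheory Metric Set Filter Topology Polynomial

/-! ### Determinants of perturbations of the identity -/

theorem ContinuousLinearMap.exists_polynomial_eval_eq_det_one_add_smul {E : Type*}
    [NormedAddCommGroup E] [NormedSpace ℝ E] [FiniteDimensional ℝ E] (A : E →L[ℝ] E) :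
    ∃ p : ℝ[X], p.natDegree ≤ Module.finrank ℝ E ∧ ∀ t : ℝ, p.eval t = (1 + t • A).det := by
  let b := Module.finBasis ℝ E
  let M := LinearMap.toMatrix b b (A : E →ₗ[ℝ] E)
  refine ⟨((X : ℝ[X]) • M.map C + (1 : Matrix _ _ ℝ).map C).det, ?_, fun t => ?_⟩
  · simpa using Polynomial.natDegree_det_X_add_C_le M 1
  · have h : LinearMap.toMatrix b b ((1 + t • A : E →L[ℝ] E) : E →ₗ[ℝ] E) = t • M + 1 := by
      rw [ContinuousLinearMap.toLinearMap_add, ContinuousLinearMap.toLinearMap_smul, map_add,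
        map_smul, add_comm]
      congr 1
      exact LinearMap.toMatrix_one b
    rw [ContinuousLinearMap.det, ← LinearMap.det_toMatrix b, h, ← Polynomial.coe_evalRingHom,
      RingHom.map_det]
    congr 1
    ext i j
    simp only [RingHom.mapMatrix_apply, Matrix.map_apply, Matrix.add_apply, Matrix.smul_apply,
      smul_eq_mul, coe_evalRingHom, eval_add, eval_mul, eval_X, eval_C]

theorem ContinuousLinearMap.det_ne_zero_of_injective {E : Type*}
    [NormedAddCommGroup E] [NormedSpace ℝ E] [FiniteDimensional ℝ E] {A : E →L[ℝ] E}
    (h : Function.Injective A) : A.det ≠ 0 := by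
  intro h0
  have h1 : LinearMap.det (A : E →ₗ[ℝ] E) = 0 := h0
  exact (LinearMap.bot_lt_ker_of_det_eq_zero h1).ne' (LinearMap.ker_eq_bot.2 h)

/-- The determinant does not vanish along the segment from `1` to `1 + A`, so it keeps its sign. -/
theorem ContinuousLinearMap.det_one_add_pos {E : Type*}
    [NormedAddCommGroup E] [NormedSpace ℝ E] [FiniteDimensional ℝ E] {A : E →L[ℝ] E}
    (hA : ‖A‖ < 1) : 0 < (1 + A).det := by
  have hne : ∀ s ∈ Icc (0 : ℝ) 1, (1 + s • A).det ≠ 0 := by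
    intro s hs
    apply det_ne_zero_of_injective
    refine (injective_iff_map_eq_zero _).2 fun v hv => ?_
    by_contra hv0
    have h1 : v = -(s • A v) := eq_neg_of_add_eq_zero_left (by simpa using hv)
    have h2 : ‖v‖ ≤ ‖A‖ * ‖v‖ := by
      calc ‖v‖ = s * ‖A v‖ := by
            conv_lhs => rw [h1]
            rw [norm_neg, norm_smul, Real.norm_of_nonneg hs.1]
        _ ≤ 1 * ‖A v‖ := by gcongr; exact hs.2
        _ ≤ ‖A‖ * ‖v‖ := by rw [one_mul]; exact A.le_opNorm v
    nlinarith [norm_pos_iff.2 hv0]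
  have hcont : Continuous fun s : ℝ => (1 + s • A).det :=
    ContinuousLinearMap.continuous_det.comp (by fun_prop)
  by_contra! hneg
  have h0 : (0 : ℝ) ∈ Icc ((1 + (1 : ℝ) • A).det) ((1 + (0 : ℝ) • A).det) := by
    refine ⟨by simpa using hneg, ?_⟩
    simp [ContinuousLinearMap.det]
  obtain ⟨s, hs, hs0⟩ := intermediate_value_Icc' zero_le_one hcont.continuousOn h0
  exact hne s hs hs0

/-! ### Lipschitz perturbations of the identity on the unit ball -/

/-- The extension by zero of a Lipschitz map that vanishes on the unit sphere has the same Lipschitz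
constant, because a segment leaving the ball crosses the sphere. -/
theorem LipschitzOnWith.indicator_closedBall {E F : Type*} [NormedAddCommGroup E] [NormedSpace ℝ E]
    [NormedAddCommGroup F] {g : E → F} {K : NNReal} (hg : LipschitzOnWith K g (closedBall 0 1))
    (h0 : ∀ x ∈ sphere (0 : E) 1, g x = 0) :
    LipschitzWith K ((closedBall (0 : E) 1).indicator g) := by
  have key : ∀ x ∈ closedBall (0 : E) 1, ∀ y ∉ closedBall (0 : E) 1,
      ‖g x‖ ≤ K * dist x y := by
    intro x hx y hy
    have hc : ContinuousOn (fun s : ℝ => ‖AffineMap.lineMap x y s‖) (Icc 0 1) := by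
      simp only [AffineMap.lineMap_apply_module]; fun_prop
    obtain ⟨s, hs, hz⟩ := intermediate_value_Icc (zero_le_one' ℝ) hc
      (show (1 : ℝ) ∈ _ from ⟨by simpa using hx, by simpa using (not_le.1 (by simpa using hy)).le⟩)
    set z : E := AffineMap.lineMap x y s with hzd
    have hzs : z ∈ sphere (0 : E) 1 := by simpa using hz
    calc ‖g x‖ = dist (g x) (g z) := by rw [h0 z hzs, dist_zero_right]
      _ ≤ K * dist x z := hg.dist_le_mul x hx z (sphere_subset_closedBall hzs)
      _ = K * (s * dist x y) := by
        rw [hzd, dist_left_lineMap, Real.norm_of_nonneg hs.1]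
      _ ≤ K * dist x y := by
        gcongr
        exact mul_le_of_le_one_left dist_nonneg hs.2
  refine LipschitzWith.of_dist_le_mul fun x y => ?_
  by_cases hx : x ∈ closedBall (0 : E) 1 <;> by_cases hy : y ∈ closedBall (0 : E) 1
  · simpa only [indicator_of_mem hx, indicator_of_mem hy] using hg.dist_le_mul x hx y hy
  · simpa only [indicator_of_mem hx, indicator_of_notMem hy, dist_zero_right] using key x hx y hy
  · simpa only [indicator_of_notMem hx, indicator_of_mem hy, dist_zero_left, dist_comm x y]
      using key y hy x hx
  · simp only [indicator_of_notMem hx, indicator_of_notMem hy, dist_self]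
    positivity

/-- If `g` vanishes on the unit sphere and `t` is small, then `id + t g` maps the unit ball
bijectively onto itself with positive Jacobian, whose integral is therefore the volume. -/
theorem setIntegral_det_one_add_smul_fderiv_eq {E : Type*} [NormedAddCommGroup E]
    [NormedSpace ℝ E] [FiniteDimensional ℝ E] [MeasurableSpace E] [BorelSpace E]
    (μ : Measure E) [μ.IsAddHaarMeasure] {g : E → E} (hg : Differentiable ℝ g) {K : NNReal}
    (hK : LipschitzOnWith K g (closedBall 0 1)) (h0 : ∀ x ∈ sphere (0 : E) 1, g x = 0)
    {t : ℝ} (ht : 0 ≤ t) (htK : t * K < 1) :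
    ∫ x in ball 0 1, (1 + t • fderiv ℝ g x).det ∂μ = μ.real (ball 0 1) := by
  set G : E → E := (closedBall (0 : E) 1).indicator g with hG
  have hGL : LipschitzWith K G := hK.indicator_closedBall h0
  have hG0 : ∀ x ∉ ball (0 : E) 1, G x = 0 := by
    intro x hx
    by_cases hx' : x ∈ closedBall (0 : E) 1
    · rw [hG, indicator_of_mem hx']
      refine h0 x ?_
      simp only [mem_ball, mem_closedBall, mem_sphere] at *
      exact le_antisymm hx' (not_lt.1 hx)
    · exact indicator_of_notMem hx' _
  set F : E → E := fun x => x + t • G x with hF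
  have happ : ApproximatesLinearOn F ((ContinuousLinearEquiv.refl ℝ E : E ≃L[ℝ] E) : E →L[ℝ] E)
      univ (Real.toNNReal t * K) := by
    rw [ApproximatesLinearOn.approximatesLinearOn_iff_lipschitzOnWith, lipschitzOnWith_univ]
    have : F - ⇑((ContinuousLinearEquiv.refl ℝ E : E ≃L[ℝ] E) : E →L[ℝ] E) = fun x => t • G x := by
      ext x; simp [hF]
    rw [this]
    refine LipschitzWith.of_dist_le_mul fun x y => ?_
    rw [dist_smul₀, Real.norm_of_nonneg ht, NNReal.coe_mul, Real.coe_toNNReal t ht, mul_assoc]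
    gcongr
    exact hGL.dist_le_mul x y
  have hc : Subsingleton E ∨ Real.toNNReal t * K <
      ‖((ContinuousLinearEquiv.refl ℝ E).symm : E →L[ℝ] E)‖₊⁻¹ := by
    rcases subsingleton_or_nontrivial E with h | h
    · exact Or.inl h
    · right
      have h1 : ‖((ContinuousLinearEquiv.refl ℝ E).symm : E →L[ℝ] E)‖₊ = 1 := by
        ext; exact ContinuousLinearMap.norm_id
      rw [h1, inv_one, ← NNReal.coe_lt_coe, NNReal.coe_mul, Real.coe_toNNReal t ht]
      exact htK
  have hinj : Function.Injective F := injOn_univ.1 (happ.injOn hc)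
  have hsurj : Function.Surjective F := happ.surjective hc
  have hFid : ∀ x ∉ ball (0 : E) 1, F x = x := fun x hx => by simp [hF, hG0 x hx]
  -- `F` is a bijection fixing the complement of the ball, so it maps the ball onto itself.
  have himg : F '' ball 0 1 = ball 0 1 := by
    refine Subset.antisymm ?_ fun y hy => ?_
    · rintro _ ⟨x, hx, rfl⟩
      by_contra h
      exact h (by rwa [hinj (hFid _ h)])
    · obtain ⟨x, rfl⟩ := hsurj y
      refine ⟨x, ?_, rfl⟩
      by_contra h
      exact h (by rwa [hFid _ h] at hy)
  have hder : ∀ x ∈ ball (0 : E) 1,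
      HasFDerivWithinAt F (1 + t • fderiv ℝ g x) (ball 0 1) x := by
    intro x hx
    have h1 : HasFDerivAt (fun x => x + t • g x) (1 + t • fderiv ℝ g x) x :=
      (hasFDerivAt_id x).add ((hg x).hasFDerivAt.const_smul t)
    refine h1.hasFDerivWithinAt.congr (fun y hy => ?_) ?_
    · simp [hF, hG, indicator_of_mem (ball_subset_closedBall hy)]
    · simp [hF, hG, indicator_of_mem (ball_subset_closedBall hx)]
  have hpos : ∀ x ∈ ball (0 : E) 1, 0 < (1 + t • fderiv ℝ g x).det := by
    intro x hx
    apply ContinuousLinearMap.det_one_add_pos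
    have h2 : ‖fderiv ℝ g x‖ ≤ K :=
      norm_fderiv_le_of_lipschitzOn ℝ (closedBall_mem_nhds_of_mem hx) hK
    rw [norm_smul, Real.norm_of_nonneg ht]
    exact (mul_le_mul_of_nonneg_left h2 ht).trans_lt htK
  have hcv := integral_image_eq_integral_abs_det_fderiv_smul μ measurableSet_ball hder
    hinj.injOn (fun _ => (1 : ℝ))
  rw [himg] at hcv
  simp only [smul_eq_mul, mul_one, integral_const, measureReal_restrict_apply_univ] at hcv
  rw [hcv]
  exact setIntegral_congr_fun measurableSet_ball fun x hx => (abs_of_pos (hpos x hx)).symm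

/-! ### No retraction of the ball onto the sphere, and the sphere is not contractible -/

/-- Differentiating `‖r‖² = 1` shows that `r x` is orthogonal to the range of the derivative. -/
theorem det_fderiv_eq_zero_of_norm_eq_one {E : Type*} [NormedAddCommGroup E]
    [InnerProductSpace ℝ E] [FiniteDimensional ℝ E] {r : E → E} (hr : Differentiable ℝ r)
    (h1 : ∀ x, ‖r x‖ = 1) (x : E) : (fderiv ℝ r x).det = 0 := by
  by_contra h
  have hu : IsUnit (LinearMap.det (fderiv ℝ r x : E →ₗ[ℝ] E)) := isUnit_iff_ne_zero.2 h
  have hs : Function.Surjective (fderiv ℝ r x) :=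
    ((Module.End.isUnit_iff _).1 ((LinearMap.isUnit_iff_isUnit_det _).2 hu)).2
  obtain ⟨v, hv⟩ := hs (r x)
  have hd := ((hr x).hasFDerivAt.norm_sq).fderiv
  have hconst : (fun y => ‖r y‖ ^ 2) = fun _ => (1 : ℝ) := by ext y; simp [h1]
  rw [hconst] at hd
  have := congrArg (fun L : E →L[ℝ] ℝ => L v) hd
  simp [hv, h1] at this

/-- **No-retraction theorem** in the `C¹` case. With `g = r - id`, the integral of
`det (1 + t Dg)` over the unit ball is a polynomial in `t` that equals the volume of the ball for
small `t ≥ 0` and vanishes at `t = 1`. Being a polynomial is used in the form of Lagrange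
interpolation of the value at `1` from values at small `t`, which avoids integrating the
coefficients. -/
theorem not_exists_contDiff_retraction_sphere {E : Type*} [NormedAddCommGroup E]
    [InnerProductSpace ℝ E] [FiniteDimensional ℝ E] {r : E → E} (hr : ContDiff ℝ 1 r)
    (h1 : ∀ x, ‖r x‖ = 1) (hid : ∀ x ∈ sphere (0 : E) 1, r x = x) : False := by
  borelize E
  let μ : Measure E := Measure.addHaar
  set g : E → E := fun x => r x - x with hgdef
  have hg : ContDiff ℝ 1 g := hr.sub contDiff_id
  have hgd : Differentiable ℝ g := hg.differentiable one_ne_zero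
  obtain ⟨K, hK⟩ : ∃ K : NNReal, LipschitzOnWith K g (closedBall 0 1) :=
    hg.contDiffOn.exists_lipschitzOnWith one_ne_zero (convex_closedBall 0 1)
      (isCompact_closedBall 0 1)
  have h0 : ∀ x ∈ sphere (0 : E) 1, g x = 0 := fun x hx => by simp [hgdef, hid x hx]
  -- Distinct interpolation nodes with `τ i * K < 1`.
  let τ : ℕ → ℝ := fun i => 1 / ((K + 1) * (i + 1))
  have hτ0 : ∀ i, 0 ≤ τ i := fun i => by positivity
  have hτK : ∀ i, τ i * K < 1 := fun i => by
    have hK0 := K.2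
    have hi : (0 : ℝ) ≤ i := i.cast_nonneg
    rw [one_div_mul_eq_div, div_lt_one (by positivity)]
    have : (0:ℝ) ≤ K * i := by positivity
    nlinarith
  have hτinj : Function.Injective τ := by
    intro i j hij
    have hK0 : (K : ℝ) + 1 ≠ 0 := by positivity
    have h2 := inv_injective (by simpa only [τ, one_div] using hij)
    exact_mod_cast add_right_cancel (mul_left_cancel₀ hK0 h2)
  let s := Finset.range (Module.finrank ℝ E + 1)
  have hinterp : ∀ x, (fderiv ℝ r x).det =
      ∑ i ∈ s, (1 + τ i • fderiv ℝ g x).det * (Lagrange.basis s τ i).eval 1 := by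
    intro x
    obtain ⟨p, hpdeg, hp⟩ := (fderiv ℝ g x).exists_polynomial_eval_eq_det_one_add_smul
    have hpi : p = Lagrange.interpolate s τ fun i => p.eval (τ i) := by
      refine Lagrange.eq_interpolate hτinj.injOn ?_
      refine (Polynomial.degree_le_natDegree).trans_lt ?_
      simp only [s, Finset.card_range]
      exact_mod_cast Nat.lt_succ_of_le hpdeg
    have hg1 : fderiv ℝ r x = 1 + (1 : ℝ) • fderiv ℝ g x := by
      have : fderiv ℝ g x = fderiv ℝ r x - 1 :=
        ((hr.differentiable one_ne_zero x).hasFDerivAt.sub (hasFDerivAt_id x)).fderiv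
      rw [this]; simp
    rw [hg1, ← hp 1]
    conv_lhs => rw [hpi]
    simp only [Lagrange.interpolate_apply, eval_finsetSum, eval_mul, eval_C, hp]
  have hsum : ∑ i ∈ s, (Lagrange.basis s τ i).eval 1 = 1 := by
    rw [← eval_finsetSum, Lagrange.sum_basis hτinj.injOn ⟨0, by simp [s]⟩, eval_one]
  have hint : ∀ i ∈ s, Integrable (fun x => (1 + τ i • fderiv ℝ g x).det *
      (Lagrange.basis s τ i).eval 1) (μ.restrict (ball 0 1)) := by
    intro i _
    have hcont : Continuous fun x => (1 + τ i • fderiv ℝ g x).det *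
        (Lagrange.basis s τ i).eval 1 := by
      refine Continuous.mul (ContinuousLinearMap.continuous_det.comp ?_) continuous_const
      have := hg.continuous_fderiv one_ne_zero
      fun_prop
    exact (hcont.continuousOn.integrableOn_compact (isCompact_closedBall 0 1)).mono_set
      ball_subset_closedBall
  have hvol : μ.real (ball (0 : E) 1) = 0 := by
    calc μ.real (ball (0 : E) 1)
        = ∑ i ∈ s, μ.real (ball (0 : E) 1) * (Lagrange.basis s τ i).eval 1 := by
          rw [← Finset.mul_sum, hsum, mul_one]
      _ = ∑ i ∈ s, ∫ x in ball 0 1, (1 + τ i • fderiv ℝ g x).det *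
            (Lagrange.basis s τ i).eval 1 ∂μ := by
          refine Finset.sum_congr rfl fun i _ => ?_
          rw [integral_mul_const,
            setIntegral_det_one_add_smul_fderiv_eq μ hgd hK h0 (hτ0 i) (hτK i)]
      _ = ∫ x in ball 0 1, (fderiv ℝ r x).det ∂μ := by
          rw [← integral_finsetSum s hint]
          simp only [hinterp]
      _ = 0 := by
          simp [det_fderiv_eq_zero_of_norm_eq_one (hr.differentiable one_ne_zero) h1]
  exact (ENNReal.toReal_pos (measure_ball_pos μ 0 one_pos).ne' measure_ball_lt_top.ne).ne' hvol

/-- A nullhomotopy of the identity gives a continuous `f : E → E` of norm one that is radial for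
`‖x‖ ≥ 1/2`. A smooth approximation of `f` within distance `1`, equal to `f` for `‖x‖ ≥ 3/4`, has no
zeros, and its normalization is a smooth retraction onto the sphere. -/
theorem not_nullhomotopic_id_sphere {E : Type*} [NormedAddCommGroup E] [InnerProductSpace ℝ E]
    [FiniteDimensional ℝ E] :
    ¬ (ContinuousMap.id (sphere (0 : E) 1)).Nullhomotopic := by
  rintro ⟨c, ⟨H⟩⟩
  let N : E → E := fun x => ‖x‖⁻¹ • x
  have hN : ∀ x : E, x ≠ 0 → ‖N x‖ = 1 := fun x hx => norm_smul_inv_norm (𝕜 := ℝ) hx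
  have hNid : ∀ x : E, ‖x‖ = 1 → N x = x := fun x hx => by simp [N, hx]
  have hNs : ∀ x : E, x ≠ 0 → ContDiffAt ℝ 1 N x := fun x hx =>
    ((contDiffAt_norm ℝ hx).inv (norm_ne_zero_iff.2 hx)).smul contDiffAt_id
  -- The time `2 - 4‖x‖`, clamped to `[0, 1]`, makes `f` constant for `‖x‖ ≤ 1/4` and radial
  -- for `‖x‖ ≥ 1/2`.
  let τ : E → I := fun x => projIcc 0 1 zero_le_one (2 - 4 * ‖x‖)
  have hτ : Continuous τ := continuous_projIcc.comp (by fun_prop)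
  let φ : ({0}ᶜ : Set E) → sphere (0 : E) 1 := fun x =>
    H (τ x, ⟨N x, mem_sphere_zero_iff_norm.2 (hN x x.2)⟩)
  have hφ : Continuous φ := by
    refine H.continuous.comp ((hτ.comp continuous_subtype_val).prodMk (Continuous.subtype_mk ?_ _))
    exact continuousOn_iff_continuous_domRestrict.1
      fun x hx => (hNs x hx).continuousAt.continuousWithinAt
  classical
  let f : E → E := fun x => if hx : x = 0 then (c : E) else (φ ⟨x, hx⟩ : E)
  have hf0 : ∀ x : E, ‖x‖ ≤ 1 / 4 → f x = c := by
    intro x hx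
    by_cases h : x = 0
    · simp [f, h]
    · have : τ x = 1 := projIcc_of_right_le _ (by linarith)
      simp only [f, h, dite_false, φ, this, H.apply_one, ContinuousMap.const_apply]
  have hf1 : ∀ x : E, 1 / 2 ≤ ‖x‖ → f x = N x := by
    intro x hx
    have h : x ≠ 0 := norm_pos_iff.1 (by linarith)
    have : τ x = 0 := projIcc_of_le_left _ (by linarith)
    simp only [f, h, dite_false, φ, this, H.apply_zero, ContinuousMap.id_apply]
  have hfn : ∀ x, ‖f x‖ = 1 := by
    intro x
    by_cases h : x = 0
    · simp only [f, h, dite_true]; exact mem_sphere_zero_iff_norm.1 c.2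
    · simp only [f, h, dite_false]; exact mem_sphere_zero_iff_norm.1 (φ _).2
  have hfc : Continuous f := by
    refine continuous_iff_continuousAt.2 fun x => ?_
    by_cases h : x = 0
    · have hev : f =ᶠ[𝓝 x] fun _ => (c : E) := by
        subst h
        filter_upwards [closedBall_mem_nhds (0 : E) (show (0 : ℝ) < 1 / 4 by norm_num)] with y hy
        exact hf0 y (mem_closedBall_zero_iff.1 hy)
      exact continuousAt_const.congr hev.symm
    · have hon : ContinuousOn f ({0}ᶜ : Set E) := by
        refine continuousOn_iff_continuous_domRestrict.2 ?_
        convert continuous_subtype_val.comp hφ using 1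
        ext y
        have hy : (y : E) ≠ 0 := y.2
        simp [f, hy]
      exact hon.continuousAt (isOpen_compl_singleton.mem_nhds h)
  obtain ⟨g, hg, hgf, hgS, -⟩ := hfc.exists_contDiff_approx_and_eqOn (1 : ℕ∞)
    (ε := fun _ => 1) continuous_const (fun _ => one_pos)
    (S := {x : E | 3 / 4 ≤ ‖x‖}) (U := {x : E | 1 / 2 < ‖x‖})
    (isClosed_le continuous_const continuous_norm)
    ((isOpen_lt continuous_const continuous_norm).mem_nhdsSet.2 fun x (hx : 3 / 4 ≤ ‖x‖) =>
      show 1 / 2 < ‖x‖ by linarith)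
    (fun x (hx : 1 / 2 < ‖x‖) =>
      (hNs x (norm_pos_iff.1 (by linarith))).contDiffWithinAt.congr
        (fun y (hy : 1 / 2 < ‖y‖) => hf1 y hy.le) (hf1 x hx.le))
  have hg0 : ∀ x, g x ≠ 0 := by
    intro x hx
    have := hgf x
    rw [hx, dist_zero_left, hfn] at this
    exact lt_irrefl _ this
  refine not_exists_contDiff_retraction_sphere (r := fun x => N (g x))
    (contDiff_iff_contDiffAt.2 fun x => (hNs _ (hg0 x)).comp x hg.contDiffAt)
    (fun x => hN _ (hg0 x)) fun x hx => ?_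
  have hx1 : ‖x‖ = 1 := mem_sphere_zero_iff_norm.1 hx
  have hgx : g x = x := by
    rw [hgS (show 3 / 4 ≤ ‖x‖ by rw [hx1]; norm_num), hf1 x (by rw [hx1]; norm_num), hNid x hx1]
  simp only [hgx, hNid x hx1]

/-! ### A global motion planner contracts the space -/

/-- Restricted to pairs `(x₀, x)`, the homotopy to the inclusion joins `id` to the end points
`x ↦ s (x₀, x) 1` and the constant map `x₀` to the starting points `x ↦ s (x₀, x) 0`; the paths
themselves join these two maps. -/
theorem HasEquivariantMotionPlanner.nullhomotopic_id {G X : Type*} [Group G] [TopologicalSpace X]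
    [MulAction G X] [Nonempty X] (h : HasEquivariantMotionPlanner G (univ : Set (X × X))) :
    (ContinuousMap.id X).Nullhomotopic := by
  obtain ⟨s, H, -, -, H0, H1⟩ := h
  obtain ⟨x₀⟩ := ‹Nonempty X›
  let ι : C(X, (univ : Set (X × X))) := ⟨fun x => ⟨(x₀, x), trivial⟩, by fun_prop⟩
  let h₁ : (⟨fun x => s (ι x) 0, by fun_prop⟩ : C(X, X)).Homotopy (ContinuousMap.const X x₀) :=
    { toFun := fun p => (H (p.1, ι p.2)).1
      continuous_toFun := by fun_prop
      map_zero_left := fun x => by rw [H0]; rfl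
      map_one_left := fun x => by rw [H1]; rfl }
  let h₂ : (⟨fun x => s (ι x) 1, by fun_prop⟩ : C(X, X)).Homotopy (ContinuousMap.id X) :=
    { toFun := fun p => (H (p.1, ι p.2)).2
      continuous_toFun := by fun_prop
      map_zero_left := fun x => by rw [H0]; rfl
      map_one_left := fun x => by rw [H1]; rfl }
  let h₃ : (⟨fun x => s (ι x) 0, by fun_prop⟩ : C(X, X)).Homotopy
      (⟨fun x => s (ι x) 1, by fun_prop⟩ : C(X, X)) :=
    { toFun := fun p => s (ι p.2) p.1
      continuous_toFun := by fun_prop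
      map_zero_left := fun x => rfl
      map_one_left := fun x => rfl }
  exact ⟨x₀, ⟨(h₃.trans h₂).symm.trans h₁⟩⟩

/-! ### Motion planners along twisted segments -/

namespace OddSphere

variable {n : ℕ}

theorem norm_coe (x : OddSphere n) : ‖(x : EuclideanSpace ℂ (Fin (n + 1)))‖ = 1 :=
  mem_sphere_zero_iff_norm.1 x.2

/-- The segment from `x` to `y` in the ambient space, with `x` rotated by `u τ` at time `τ`:
`(1 - τ) u(τ) x + τ y`. -/
noncomputable def twistedSegment (u : C(I, Circle)) (p : OddSphere n × OddSphere n) (τ : I) :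
    EuclideanSpace ℂ (Fin (n + 1)) :=
  (1 - (τ : ℝ)) • ((u τ : ℂ) • (p.1 : EuclideanSpace ℂ (Fin (n + 1)))) + (τ : ℝ) •
    (p.2 : EuclideanSpace ℂ (Fin (n + 1)))

/-- The pairs whose twisted segment misses the origin at its midpoint. -/
def midpointNeZero (n : ℕ) (u : C(I, Circle)) : Set (OddSphere n × OddSphere n) :=
  {p | twistedSegment u p ⟨1 / 2, by norm_num, by norm_num⟩ ≠ 0}

theorem continuous_twistedSegment (u : C(I, Circle)) :
    Continuous fun q : (OddSphere n × OddSphere n) × I => twistedSegment u q.1 q.2 := by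
  unfold twistedSegment
  fun_prop

theorem twistedSegment_smul (u : C(I, Circle)) (z : Circle) (p : OddSphere n × OddSphere n)
    (τ : I) : twistedSegment u (z • p) τ = (z : ℂ) • twistedSegment u p τ := by
  simp only [twistedSegment, Prod.smul_fst, Prod.smul_snd, coe_circle_smul, smul_add]
  rw [smul_comm (u τ : ℂ) (z : ℂ), smul_comm (1 - (τ : ℝ)) (z : ℂ), smul_comm (τ : ℝ) (z : ℂ)]

/-- The two terms of the twisted segment have norms `1 - τ` and `τ`, so they can only cancel at
`τ = 1/2`. -/
theorem twistedSegment_ne_zero (u : C(I, Circle)) {p : OddSphere n × OddSphere n}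
    (hp : p ∈ midpointNeZero n u) (τ : I) : twistedSegment u p τ ≠ 0 := by
  intro h
  have h1 := congrArg norm (eq_neg_of_add_eq_zero_left h)
  rw [norm_neg, norm_smul, norm_smul, norm_smul, Circle.norm_coe, norm_coe, norm_coe,
    Real.norm_of_nonneg (sub_nonneg.2 τ.2.2), Real.norm_of_nonneg τ.2.1] at h1
  have h2 : τ = ⟨1 / 2, by norm_num, by norm_num⟩ := Subtype.ext (by simp only; linarith)
  exact hp (h2 ▸ h)

theorem isOpen_midpointNeZero (u : C(I, Circle)) : IsOpen (midpointNeZero n u) :=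
  isOpen_ne_fun ((continuous_twistedSegment u).comp (by fun_prop : Continuous fun p => (p, _)))
    continuous_const

theorem smul_mem_midpointNeZero (u : C(I, Circle)) (z : Circle) {p : OddSphere n × OddSphere n}
    (hp : p ∈ midpointNeZero n u) : z • p ∈ midpointNeZero n u := by
  rw [midpointNeZero, mem_ofPred_eq, twistedSegment_smul]
  exact smul_ne_zero z.coe_ne_zero hp

theorem norm_inv_norm_smul_twistedSegment (u : C(I, Circle)) (q : midpointNeZero n u × I) :
    ‖‖twistedSegment u (q.1 : OddSphere n × OddSphere n) q.2‖⁻¹ •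
      twistedSegment u (q.1 : OddSphere n × OddSphere n) q.2‖ = 1 := by
  rw [norm_smul, norm_inv, norm_norm,
    inv_mul_cancel₀ (norm_ne_zero_iff.2 (twistedSegment_ne_zero u q.1.2 q.2))]

theorem continuous_inv_norm_smul_twistedSegment (u : C(I, Circle)) :
    Continuous fun q : midpointNeZero n u × I =>
      ‖twistedSegment u (q.1 : OddSphere n × OddSphere n) q.2‖⁻¹ •
        twistedSegment u (q.1 : OddSphere n × OddSphere n) q.2 := by
  have hc : Continuous fun q : midpointNeZero n u × I =>
      twistedSegment u (q.1 : OddSphere n × OddSphere n) q.2 :=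
    (continuous_twistedSegment u).comp
      ((continuous_subtype_val.comp continuous_fst).prodMk continuous_snd)
  exact (hc.norm.inv₀ fun q => norm_ne_zero_iff.2 (twistedSegment_ne_zero u q.1.2 q.2)).smul hc

/-- The twisted segment pushed radially onto the sphere, as a map jointly continuous in the pair
of points and the time. -/
noncomputable def twistedPath (u : C(I, Circle)) : C(midpointNeZero n u × I, OddSphere n) where
  toFun q := ⟨‖twistedSegment u (q.1 : OddSphere n × OddSphere n) q.2‖⁻¹ •
      twistedSegment u (q.1 : OddSphere n × OddSphere n) q.2,
    mem_sphere_zero_iff_norm.2 (norm_inv_norm_smul_twistedSegment u q)⟩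
  continuous_toFun := (continuous_inv_norm_smul_twistedSegment u).subtype_mk _

theorem coe_twistedPath (u : C(I, Circle)) (q : midpointNeZero n u × I) :
    (twistedPath u q : EuclideanSpace ℂ (Fin (n + 1))) =
      ‖twistedSegment u (q.1 : OddSphere n × OddSphere n) q.2‖⁻¹ •
        twistedSegment u (q.1 : OddSphere n × OddSphere n) q.2 := rfl

theorem twistedPath_smul (u : C(I, Circle)) (z : Circle) {p q : midpointNeZero n u}
    (h : (q : OddSphere n × OddSphere n) = z • (p : OddSphere n × OddSphere n)) (τ : I) :
    twistedPath u (q, τ) = z • twistedPath u (p, τ) := by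
  refine Subtype.ext ?_
  rw [coe_circle_smul, coe_twistedPath, coe_twistedPath, h, twistedSegment_smul, norm_smul,
    Circle.norm_coe, one_mul]
  exact smul_comm _ _ _

theorem twistedPath_zero {u : C(I, Circle)} (hu : u 0 = 1) (p : midpointNeZero n u) :
    twistedPath u (p, 0) = (p : OddSphere n × OddSphere n).1 := by
  refine Subtype.ext ?_
  simp [coe_twistedPath, twistedSegment, hu]

theorem twistedPath_one (u : C(I, Circle)) (p : midpointNeZero n u) :
    twistedPath u (p, 1) = (p : OddSphere n × OddSphere n).2 := by
  refine Subtype.ext ?_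
  simp [coe_twistedPath, twistedSegment]

theorem hasEquivariantMotionPlanner_midpointNeZero (Γ : Subgroup Circle) {u : C(I, Circle)}
    (hu : u 0 = 1) : HasEquivariantMotionPlanner Γ (midpointNeZero n u) :=
  ⟨(twistedPath u).curry, ContinuousMap.comp ⟨Subtype.val, continuous_subtype_val⟩
    ContinuousMap.snd, fun g _ _ h τ => twistedPath_smul u (g : Circle) h τ,
    fun _ _ _ h _ => h,
    fun p => (Prod.ext (twistedPath_zero hu p) (twistedPath_one u p)).symm, fun _ => rfl⟩

end OddSphere

/-- The loop once around the circle. -/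
noncomputable def circleLoop : C(I, Circle) :=
  ⟨fun τ => Circle.exp (2 * Real.pi * τ), by fun_prop⟩

/-- The midpoints for the two choices of `u` are `(x + y) / 2` and `(y - x) / 2`, which cannot both
vanish. -/
theorem OddSphere.midpointNeZero_one_union_circleLoop (n : ℕ) :
    midpointNeZero n 1 ∪ midpointNeZero n circleLoop = univ := by
  refine eq_univ_of_forall fun p => ?_
  by_contra h
  simp only [mem_union, midpointNeZero, mem_ofPred_eq, not_or, not_not] at h
  obtain ⟨h1, h2⟩ := h
  have hpi : (2 * Real.pi * (1 / 2 : ℝ)) = Real.pi := by ring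
  have hloop : ((circleLoop ⟨1 / 2, by norm_num, by norm_num⟩ : Circle) : ℂ) = -1 := by
    simp only [circleLoop, ContinuousMap.coe_mk, hpi, Circle.coe_exp, Complex.exp_pi_mul_I]
  simp only [twistedSegment, hloop, ContinuousMap.one_apply, Circle.coe_one, one_smul,
    neg_smul, smul_neg] at h1 h2
  have hy : (p.2 : EuclideanSpace ℂ (Fin (n + 1))) = 0 := by
    have h3 := congrArg₂ (· + ·) h1 h2
    simp only [add_zero] at h3
    have h4 : (1 : ℝ) • (p.2 : EuclideanSpace ℂ (Fin (n + 1))) = 0 := by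
      refine Eq.trans ?_ h3
      module
    simpa using h4
  have := norm_coe p.2
  simp [hy] at this

/-! ### The equivariant topological complexity of the odd sphere -/

theorem lemma4p2 (t : ℕ∞) (ht : 1 ≤ t) (n : ℕ) :
    equivariantTC (circleZ t) (OddSphere n) = 1 := by
  refine le_antisymm (sInf_le ⟨1, rfl,
    ![OddSphere.midpointNeZero n 1, OddSphere.midpointNeZero n circleLoop], ?_, ?_⟩)
    (le_sInf ?_)
  · rw [← OddSphere.midpointNeZero_one_union_circleLoop n]
    ext p
    simp [Fin.exists_fin_two]
  · have key : ∀ u : C(I, Circle), u 0 = 1 → IsOpen (OddSphere.midpointNeZero n u) ∧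
        (∀ (g : circleZ t), ∀ p ∈ OddSphere.midpointNeZero n u,
          g • p ∈ OddSphere.midpointNeZero n u) ∧
        HasEquivariantMotionPlanner (circleZ t) (OddSphere.midpointNeZero n u) := fun u hu =>
      ⟨OddSphere.isOpen_midpointNeZero u,
        fun g _ hp => OddSphere.smul_mem_midpointNeZero u (g : Circle) hp,
        OddSphere.hasEquivariantMotionPlanner_midpointNeZero _ hu⟩
    exact Fin.forall_fin_two.2 ⟨key 1 rfl, key circleLoop (by simp [circleLoop])⟩
  · rintro _ ⟨k, rfl, U, hU, hplan⟩
    rw [Nat.one_le_cast, Nat.one_le_iff_ne_zero]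
    rintro rfl
    have hU0 : U 0 = univ := by
      refine eq_univ_of_forall fun p => ?_
      obtain ⟨j, hj⟩ := mem_iUnion.1 (hU ▸ mem_univ p)
      rwa [Fin.fin_one_eq_zero j] at hj
    have hP := (hplan 0).2.2
    rw [hU0] at hP
    have : Nonempty (OddSphere n) := (NormedSpace.sphere_nonempty.2 zero_le_one).to_subtype
    exact not_nullhomotopic_id_sphere hP.nullhomotopic_id
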